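/- For a Hermitian matrix $A\in\mathbb C^{d\times d}$ let $\mathrm{spec}(A)$ be the vector of its eigenvalues, with multiplicity, sorted from largest to smallest, let $\mathrm{spec}(A)_{\le r}$ be the vector of the first $r$ of them, and let $\|A\|_\infty$ be the operator norm. For real vectors $x,y$ of the same length let $d_{\mathrm{TV}}(x,y)=\frac12\sum_i|x_i-y_i|$. A $d$-dimensional state is a positive semidefinite matrix $\rho\in\mathbb C^{d\times d}$ of trace $1$. Measuring $\rho$ with the uniform POVM yields a random unit vector $u\in\mathbb C^d$ with density $d\cdot\mathrm{tr}(|u\rangle\langle u|\,\rho)$ with respect to the unitarily invariant probability measure on the unit sphere of $\mathbb C^d$. Given a threshold $B$, the uniform POVM bucketing algorithm measures each of $n$ copies of $\rho$ independently with the uniform POVM, obtaining $u_1,\dots,u_n$, sets $$\hat\rho=\frac1n\sum_{i=1}^n\bigl((d+1)|u_i\rangle\langle u_i|-I\bigr),$$ and lets $\Pi$ be the orthogonal projector onto the span of the eigenvectors of $\hat\rho$ with eigenvalue at least $B$. Write $\bar\Pi=I-\Pi$ and $r=\mathrm{rank}(\Pi)$. **Theorem.** There is a universal constant $C>0$ such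 that for every $d$, every $d$-dimensional state $\rho$, all $0<B\le1$ and $0<\varepsilon\le1$, and every integer $n\ge C\,d\,B^{-2}\varepsilon^{-2}$, with probability at least $0.99$ the following hold simultaneously: 1. $d_{\mathrm{TV}}\bigl(\mathrm{spec}(\hat\rho)_{\le r},\mathrm{spec}(\rho)_{\le r}\bigr)\le\varepsilon$ and $r\le\frac{3}{2B}$; 2. $\|\bar\Pi\rho\bar\Pi\|_\infty\le(1+\varepsilon)B$; 3. $d_{\mathrm{TV}}\bigl(\mathrm{spec}(\Pi\rho\Pi+\bar\Pi\rho\bar\Pi),\mathrm{spec}(\rho)\bigr)\le\varepsilon$. -/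

import Mathlib

open MeasureTheory
open scoped ENNReal ComplexOrder

namespace UniformPOVM

noncomputable section

/-- A density matrix (mixed state) on `ℂ^d`: positive semidefinite with trace one. -/
structure IsDensityMatrix {d : ℕ} (ρ : Matrix (Fin d) (Fin d) ℂ) : Prop where
  posSemidef : ρ.PosSemidef
  trace_eq_one : ρ.trace = 1

/-- Total variation distance of two real vectors: half of the `ℓ¹` distance. -/
def dTV {ι : Type*} [Fintype ι] (x y : ι → ℝ) : ℝ :=
  (1 / 2) * ∑ i, |x i - y i|

/-- Operator norm (Schatten `∞`-norm) of a matrix acting on the Hilbert space `ℂ^d`. -/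
def opNorm {d : ℕ} (M : Matrix (Fin d) (Fin d) ℂ) : ℝ :=
  ‖Matrix.toEuclideanCLM (n := Fin d) (𝕜 := ℂ) M‖

/-- The eigenvalues of a Hermitian matrix, with multiplicity, sorted from largest to smallest. -/
def spec {d : ℕ} {A : Matrix (Fin d) (Fin d) ℂ} (hA : A.IsHermitian) : Fin d → ℝ :=
  fun i => hA.eigenvalues₀ (Fin.cast (Fintype.card_fin d).symm i)

/-- The first `r` entries of a vector (all the entries if `d ≤ r`). -/
def firstEntries {d : ℕ} (r : ℕ) (x : Fin d → ℝ) : {i : Fin d // (i : ℕ) < r} → ℝ :=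
  fun i => x i

/-- Unit vectors of `ℂ^d`, representing pure states. -/
abbrev PureState (d : ℕ) : Type :=
  Metric.sphere (0 : EuclideanSpace ℂ (Fin d)) 1

/-- The rank-one projector `|u⟩⟨u|`. -/
def ketbra {d : ℕ} (u : PureState d) : Matrix (Fin d) (Fin d) ℂ :=
  Matrix.vecMulVec (fun i => u.1 i) (fun i => star (u.1 i))

/-- The law of a Haar random vector in `ℂ^d`: the uniform (unitarily invariant) probability
measure on the unit sphere, that is the surface measure divided by its total mass. -/
def haarPure (d : ℕ) : Measure (PureState d) :=
  ((volume : Measure (EuclideanSpace ℂ (Fin d))).toSphere Set.univ)⁻¹ •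
    (volume : Measure (EuclideanSpace ℂ (Fin d))).toSphere

/-- The law of the outcome when `ρ` is measured with the uniform POVM `{d · |u⟩⟨u| · du}`:
it has density `d · tr(|u⟩⟨u| ρ)` with respect to the Haar measure `du` over pure states. -/
def uniformPOVM {d : ℕ} (ρ : Matrix (Fin d) (Fin d) ℂ) : Measure (PureState d) :=
  (haarPure d).withDensity fun u => ENNReal.ofReal ((d : ℝ) * (ketbra u * ρ).trace.re)

/-- The joint law of the outcomes when each of `n` copies of `ρ` is measured with the
uniform POVM. -/
def uniformPOVMCopies {d : ℕ} (ρ : Matrix (Fin d) (Fin d) ℂ) (n : ℕ) :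
    Measure (Fin n → PureState d) :=
  Measure.pi fun _ => uniformPOVM ρ

/-- The output of uniform POVM tomography on the outcomes `u₁, …, uₙ`: the average of the
matrices `(d + 1) |uᵢ⟩⟨uᵢ| - I`. -/
def estimate {d n : ℕ} (u : Fin n → PureState d) : Matrix (Fin d) (Fin d) ℂ :=
  ((1 / n : ℝ) : ℂ) • ∑ i, (((d : ℂ) + 1) • ketbra (u i) - 1)

/-- The projector onto the span of the eigenvectors of the Hermitian matrix `A` with
eigenvalue at least `B`. -/
def thresholdProj {d : ℕ} {A : Matrix (Fin d) (Fin d) ℂ} (hA : A.IsHermitian) (B : ℝ) :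
    Matrix (Fin d) (Fin d) ℂ :=
  ∑ j : Fin d, if B ≤ hA.eigenvalues j then
    Matrix.vecMulVec (fun i => hA.eigenvectorBasis j i)
      (fun i => star (hA.eigenvectorBasis j i))
  else 0

theorem isHermitian_vecMulVec {d : ℕ} (v : Fin d → ℂ) :
    (Matrix.vecMulVec v (fun i => star (v i))).IsHermitian := by
  ext i j
  simp [Matrix.vecMulVec_apply, mul_comm]

theorem isHermitian_estimate {d n : ℕ} (u : Fin n → PureState d) :
    (estimate u).IsHermitian := by
  have h : ∀ i, (ketbra (u i)).conjTranspose = ketbra (u i) :=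
    fun i => isHermitian_vecMulVec _
  simp [Matrix.IsHermitian, estimate, Matrix.conjTranspose_smul, Matrix.conjTranspose_sum, h]

theorem isHermitian_thresholdProj {d : ℕ} {A : Matrix (Fin d) (Fin d) ℂ} (hA : A.IsHermitian)
    (B : ℝ) : (thresholdProj hA B).IsHermitian := by
  unfold Matrix.IsHermitian thresholdProj
  rw [Matrix.conjTranspose_sum]
  refine Finset.sum_congr rfl fun j _ => ?_
  split_ifs
  · exact isHermitian_vecMulVec _
  · simp

/-- The projector `Π` output by the uniform POVM bucketing algorithm with threshold `B` on the
measurement outcomes `u`. -/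
def bucket {d n : ℕ} (B : ℝ) (u : Fin n → PureState d) : Matrix (Fin d) (Fin d) ℂ :=
  thresholdProj (isHermitian_estimate u) B

/-- The pinched matrix `P ρ P + (1 - P) ρ (1 - P)`. -/
def pinch {d : ℕ} (P ρ : Matrix (Fin d) (Fin d) ℂ) : Matrix (Fin d) (Fin d) ℂ :=
  P * ρ * P + (1 - P) * ρ * (1 - P)

theorem isHermitian_pinch {d : ℕ} {P ρ : Matrix (Fin d) (Fin d) ℂ}
    (hP : P.IsHermitian) (hρ : ρ.IsHermitian) : (pinch P ρ).IsHermitian := by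
  have hP' : P.conjTranspose = P := hP
  have hρ' : ρ.conjTranspose = ρ := hρ
  simp [Matrix.IsHermitian, pinch, Matrix.conjTranspose_mul, hP', hρ', mul_assoc]

theorem isHermitian_bucket {d n : ℕ} (B : ℝ) (u : Fin n → PureState d) :
    (bucket B u).IsHermitian :=
  isHermitian_thresholdProj _ B

end

end UniformPOVM

/-!
Let `σ` be the estimate of `ρ`. For a unit vector `v`, the outcome `u` of the uniform POVM satisfies
`𝔼 (d + 1)|⟨v, u⟩|² = 1 + ⟨v, ρ v⟩` and `𝔼 ((d + 1)|⟨v, u⟩|²)ᵏ ≤ (k + 1)!`, both by computing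
moments on the sphere. Hence a Bernstein inequality holds for each quadratic form `⟨v, (σ - ρ) v⟩`,
and a union bound over a net of `exp (O(d))` unit vectors gives `‖σ - ρ‖ ≤ δ := B ε / 4` with
probability at least `0.99`.

The rest is deterministic. Weyl's inequality compares the leading eigenvalues, and `B P ≤ P σ P`
together with `tr ρ = 1` bounds the rank `r` of the threshold projector `P`. For the pinching, put
`Q := 1 - P` and `D := ρ - σ`: as `P` commutes with `σ`, the pinched state is
`ρ - (P D Q + Q D P)`. Both `ρ` and the pinched state lie below `ρ + δ P + δ⁻¹ Q D P D Q`, which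
exceeds each of them in trace by at most `2 r δ`; as ordered spectra are monotone, this bounds the
distance between the two spectra.
-/

namespace UniformPOVM

open Metric Module ProbabilityTheory Real
open scoped InnerProductSpace NNReal Nat

section SphereMoments

theorem integral_eq_integral_toSphere_mul {E : Type*} [NormedAddCommGroup E] [NormedSpace ℝ E]
    [FiniteDimensional ℝ E] [Nontrivial E] [MeasurableSpace E] [BorelSpace E] (μ : Measure E)
    [μ.IsAddHaarMeasure] {F : E → ℝ} {f : Metric.sphere (0 : E) 1 → ℝ} {g : ℝ → ℝ}
    (hF : ∀ (u : Metric.sphere (0 : E) 1) (r : ℝ), 0 < r → F (r • u.1) = f u * g r) :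
    ∫ x, F x ∂μ =
      (∫ u, f u ∂μ.toSphere) * ∫ r in Set.Ioi (0 : ℝ), r ^ (finrank ℝ E - 1) * g r := by
  have hpolar (x : ({0}ᶜ : Set E)) : F x = f (homeomorphUnitSphereProd E x).1 *
      g (homeomorphUnitSphereProd E x).2 := by
    have hx : 0 < ‖x.1‖ := norm_pos_iff.2 x.2
    have h := hF (homeomorphUnitSphereProd E x).1 ‖x.1‖ hx
    rwa [homeomorphUnitSphereProd_apply_fst_coe, smul_inv_smul₀ hx.ne',
      ← homeomorphUnitSphereProd_apply_snd_coe] at h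
  have hradial : ∫ r : Set.Ioi (0 : ℝ), g r ∂.volumeIoiPow (finrank ℝ E - 1) =
      ∫ r in Set.Ioi (0 : ℝ), r ^ (finrank ℝ E - 1) * g r := by
    simp only [Measure.volumeIoiPow, ENNReal.ofReal]
    rw [integral_withDensity_eq_integral_smul (measurable_subtype_coe.pow_const _).real_toNNReal,
      integral_subtype_comap measurableSet_Ioi
        fun r => Real.toNNReal (r ^ (finrank ℝ E - 1)) • g r]
    refine setIntegral_congr_fun measurableSet_Ioi fun r hr => ?_
    rw [NNReal.smul_def, Real.coe_toNNReal _ (pow_nonneg (le_of_lt hr) _), smul_eq_mul]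
  calc
    ∫ x, F x ∂μ = ∫ x : ({0}ᶜ : Set E), F x ∂(μ.comap (↑)) := by
      rw [integral_subtype_comap (measurableSet_singleton _).compl F, restrict_compl_singleton]
    _ = ∫ x, f x.1 * g x.2 ∂μ.toSphere.prod (.volumeIoiPow (finrank ℝ E - 1)) := by
      simp_rw [hpolar]
      exact μ.measurePreserving_homeomorphUnitSphereProd.integral_comp
        (Homeomorph.measurableEmbedding _) fun x => f x.1 * g x.2
    _ = _ := by rw [← hradial]; exact integral_prod_mul f (fun r : Set.Ioi (0 : ℝ) => g r)

theorem integral_norm_pow_mul_exp_neg_sq (k : ℕ) :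
    ∫ z : ℂ, ‖z‖ ^ (2 * k) * exp (-‖z‖ ^ 2) = π * k ! := by
  have h := Complex.integral_rpow_mul_exp_neg_rpow (p := 2) (q := ((2 * k : ℕ) : ℝ)) one_le_two
    (lt_of_lt_of_le (by norm_num) (Nat.cast_nonneg _))
  simp only [rpow_natCast, rpow_ofNat] at h
  rw [h, show (((2 * k : ℕ) : ℝ) + 2) / 2 = k + 1 by push_cast; ring, Gamma_nat_eq_factorial]
  ring

theorem integral_Ioi_pow_mul_exp_neg_sq (m : ℕ) :
    ∫ r in Set.Ioi (0 : ℝ), r ^ (2 * m + 1) * exp (-r ^ 2) = m ! / 2 := by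
  have h := integral_rpow_mul_exp_neg_rpow (p := 2) (q := ((2 * m + 1 : ℕ) : ℝ)) two_pos
    (neg_one_lt_zero.trans_le (Nat.cast_nonneg _))
  simp only [rpow_natCast, rpow_ofNat] at h
  rw [h, show (((2 * m + 1 : ℕ) : ℝ) + 1) / 2 = m + 1 by push_cast; ring, Gamma_nat_eq_factorial]
  ring

theorem integral_pi_norm_pow_mul_exp_neg_sum_sq {ι : Type*} [Fintype ι] (i : ι) (k : ℕ) :
    ∫ z : ι → ℂ, ‖z i‖ ^ (2 * k) * exp (-∑ j, ‖z j‖ ^ 2) = π ^ Fintype.card ι * k ! := by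
  classical
  have hprod (z : ι → ℂ) : ‖z i‖ ^ (2 * k) * exp (-∑ j, ‖z j‖ ^ 2) =
      ∏ j, ‖z j‖ ^ (2 * if j = i then k else 0) * exp (-‖z j‖ ^ 2) := by
    rw [Finset.prod_mul_distrib, ← exp_sum, Finset.sum_neg_distrib,
      Fintype.prod_eq_single (f := fun j => ‖z j‖ ^ (2 * if j = i then k else 0)) i
        (by simp +contextual), if_pos rfl]
  simp_rw [hprod]
  rw [integral_fintype_prod_volume_eq_prod
    fun j (z : ℂ) => ‖z‖ ^ (2 * if j = i then k else 0) * exp (-‖z‖ ^ 2)]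
  simp_rw [integral_norm_pow_mul_exp_neg_sq, Finset.prod_mul_distrib, Finset.prod_const]
  rw [Fintype.prod_eq_single (f := fun j => ((if j = i then k else 0)! : ℝ)) i
    (by simp +contextual), if_pos rfl, Finset.card_univ]

variable {E : Type*} [NormedAddCommGroup E] [InnerProductSpace ℂ E] [FiniteDimensional ℂ E]

theorem exists_orthonormalBasis_eq_norm_smul [Nontrivial E] (v : E) :
    ∃ (b : OrthonormalBasis (Fin (finrank ℂ E)) ℂ E) (i : Fin (finrank ℂ E)),
      v = (‖v‖ : ℂ) • b i := by
  obtain ⟨e, he, hev⟩ : ∃ e : E, ‖e‖ = 1 ∧ v = (‖v‖ : ℂ) • e := by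
    rcases eq_or_ne v 0 with rfl | hv
    · obtain ⟨e, he⟩ := exists_norm_eq E zero_le_one
      exact ⟨e, he, by simp⟩
    · exact ⟨(‖v‖ : ℂ)⁻¹ • v, norm_smul_inv_norm hv,
        (smul_inv_smul₀ (Complex.ofReal_ne_zero.2 (norm_ne_zero_iff.2 hv)) v).symm⟩
  let i : Fin (finrank ℂ E) := ⟨0, finrank_pos⟩
  have horth : Orthonormal ℂ (({i} : Set (Fin (finrank ℂ E))).domRestrict fun _ => e) :=
    ⟨fun _ => he, fun j l hjl => absurd (Subsingleton.elim j l) hjl⟩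
  obtain ⟨b, hb⟩ := horth.exists_orthonormalBasis_extension_of_card_eq (Fintype.card_fin _).symm
  exact ⟨b, i, by rwa [hb i rfl]⟩

variable [MeasurableSpace E] [BorelSpace E]

theorem exists_integral_eq_mul_integral_pi {ι : Type*} [Fintype ι] (b : OrthonormalBasis ι ℂ E)
    (μ : Measure E) [μ.IsAddHaarMeasure] :
    ∃ c : ℝ, ∀ f : E → ℝ,
      ∫ x, f x ∂μ = c * ∫ z : ι → ℂ, f (b.repr.symm (WithLp.toLp 2 z)) := by
  let L : (ι → ℂ) ≃L[ℝ] E := (((WithLp.linearEquiv 2 ℂ (ι → ℂ)).symm.trans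
    b.repr.symm.toLinearEquiv).restrictScalars ℝ).toContinuousLinearEquiv
  have : ((volume : Measure (ι → ℂ)).map L).IsAddHaarMeasure := L.isAddHaarMeasure_map volume
  refine ⟨μ.addHaarScalarFactor ((volume : Measure (ι → ℂ)).map L), fun f => ?_⟩
  conv_lhs => rw [μ.isAddLeftInvariant_eq_smul ((volume : Measure (ι → ℂ)).map L),
    integral_smul_nnreal_measure]
  exact congrArg _ (L.toHomeomorph.measurableEmbedding.integral_map f)

theorem integral_inner_basis_pow_mul_exp_neg_sq {ι : Type*} [Fintype ι]
    (b : OrthonormalBasis ι ℂ E) (μ : Measure E) [μ.IsAddHaarMeasure] (i : ι) (k : ℕ) :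
    ∫ x, ‖⟪b i, x⟫_ℂ‖ ^ (2 * k) * exp (-‖x‖ ^ 2) ∂μ = k ! * ∫ x, exp (-‖x‖ ^ 2) ∂μ := by
  obtain ⟨c, hc⟩ := exists_integral_eq_mul_integral_pi b μ
  have hcoord (k : ℕ) : ∫ x, ‖⟪b i, x⟫_ℂ‖ ^ (2 * k) * exp (-‖x‖ ^ 2) ∂μ =
      c * (π ^ Fintype.card ι * k !) := by
    simp_rw [hc, ← b.repr_apply_apply, b.repr.apply_symm_apply, b.repr.symm.norm_map,
      EuclideanSpace.norm_sq_eq, integral_pi_norm_pow_mul_exp_neg_sum_sq]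
  have hzero := hcoord 0
  simp only [mul_zero, pow_zero, one_mul, Nat.factorial_zero, Nat.cast_one, mul_one] at hzero
  rw [hcoord, hzero]
  ring

variable [Nontrivial E] (μ : Measure E) [μ.IsAddHaarMeasure]

theorem integral_inner_pow_mul_exp_neg_sq (v : E) (k : ℕ) :
    ∫ x, ‖⟪v, x⟫_ℂ‖ ^ (2 * k) * exp (-‖x‖ ^ 2) ∂μ =
      ‖v‖ ^ (2 * k) * (k ! * ∫ x, exp (-‖x‖ ^ 2) ∂μ) := by
  obtain ⟨b, i, hv⟩ := exists_orthonormalBasis_eq_norm_smul v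
  have hinner (x : E) : ‖⟪v, x⟫_ℂ‖ = ‖v‖ * ‖⟪b i, x⟫_ℂ‖ := by
    rw [hv, inner_smul_left, norm_mul, RCLike.norm_conj, norm_smul, b.norm_eq_one, mul_one]
  simp_rw [hinner, mul_pow, mul_assoc]
  rw [integral_const_mul, integral_inner_basis_pow_mul_exp_neg_sq]

theorem integral_inner_pow_mul_exp_neg_sq_eq_integral_toSphere (v : E) (k : ℕ) :
    ∫ x, ‖⟪v, x⟫_ℂ‖ ^ (2 * k) * exp (-‖x‖ ^ 2) ∂μ =
      (∫ u, ‖⟪v, u.1⟫_ℂ‖ ^ (2 * k) ∂μ.toSphere) * ((finrank ℂ E + k - 1)! / 2) := by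
  have hE : 0 < finrank ℂ E := finrank_pos
  rw [integral_eq_integral_toSphere_mul μ (f := fun u => ‖⟪v, u.1⟫_ℂ‖ ^ (2 * k))
    (g := fun r => r ^ (2 * k) * exp (-r ^ 2)), finrank_real_of_complex,
    ← integral_Ioi_pow_mul_exp_neg_sq]
  · simp_rw [← mul_assoc, ← pow_add]
    rw [show 2 * finrank ℂ E - 1 + 2 * k = 2 * (finrank ℂ E + k - 1) + 1 by omega]
  · intro u r hr
    rw [inner_smul_right_eq_smul, norm_smul, norm_smul, norm_eq_of_mem_sphere u,
      Real.norm_of_nonneg hr.le]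
    ring_nf

theorem average_toSphere_inner_pow (v : E) (k : ℕ) :
    ⨍ u, ‖⟪v, u.1⟫_ℂ‖ ^ (2 * k) ∂μ.toSphere =
      ‖v‖ ^ (2 * k) / (finrank ℂ E).multichoose k := by
  have hE : 0 < finrank ℂ E := finrank_pos
  have hmass := integral_inner_pow_mul_exp_neg_sq_eq_integral_toSphere μ v 0
  have hmoment := integral_inner_pow_mul_exp_neg_sq_eq_integral_toSphere μ v k
  rw [integral_inner_pow_mul_exp_neg_sq] at hmass hmoment
  simp only [mul_zero, pow_zero, integral_const, smul_eq_mul, mul_one, Nat.factorial_zero,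
    Nat.cast_one, add_zero, one_mul] at hmass
  have hsphere : μ.toSphere.real Set.univ ≠ 0 :=
    (measureReal_ne_zero_iff).2 (Measure.measure_univ_ne_zero.2 (Measure.toSphere_ne_zero _))
  have hchoose : ((finrank ℂ E).multichoose k : ℝ) * (k ! * (finrank ℂ E - 1)!) =
      (finrank ℂ E + k - 1)! := by
    have := Nat.choose_mul_factorial_mul_factorial (show k ≤ finrank ℂ E + k - 1 by omega)
    rw [show finrank ℂ E + k - 1 - k = finrank ℂ E - 1 by omega, mul_assoc] at this
    rw [Nat.multichoose_eq]
    exact_mod_cast this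
  have hpos : (0 : ℝ) < (finrank ℂ E).multichoose k := by
    exact_mod_cast Nat.multichoose_eq _ _ ▸ Nat.choose_pos (by omega)
  rw [average_eq, smul_eq_mul, inv_mul_eq_iff_eq_mul₀ hsphere, ← mul_div_assoc, eq_div_iff hpos.ne']
  rw [hmass, ← hchoose] at hmoment
  have hk : (k ! * (finrank ℂ E - 1)! : ℝ) ≠ 0 := by positivity
  apply mul_right_cancel₀ hk
  linarith

end SphereMoments

section Design

theorem integrable_of_continuous {X : Type*} [TopologicalSpace X] [CompactSpace X]
    [MeasurableSpace X] [OpensMeasurableSpace X] {μ : Measure X} [IsFiniteMeasureOnCompacts μ]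
    {f : X → ℝ} (hf : Continuous f) : Integrable f μ :=
  hf.integrable_of_hasCompactSupport (.of_compactSpace f)

theorem sum_norm_pow_four_eq {E : Type*} [SeminormedAddCommGroup E] [InnerProductSpace ℂ E]
    (v w : E) :
    ‖v + w‖ ^ 4 + ‖v - w‖ ^ 4 + ‖v + Complex.I • w‖ ^ 4 + ‖v - Complex.I • w‖ ^ 4 =
      4 * ‖v‖ ^ 4 + 4 * ‖w‖ ^ 4 + 8 * (‖v‖ ^ 2 * ‖w‖ ^ 2 + ‖⟪v, w⟫_ℂ‖ ^ 2) := by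
  have hpair (z : E) : ‖v + z‖ ^ 4 + ‖v - z‖ ^ 4 =
      2 * (‖v‖ ^ 2 + ‖z‖ ^ 2) ^ 2 + 8 * (⟪v, z⟫_ℂ).re ^ 2 := by
    have hadd := norm_add_sq (𝕜 := ℂ) v z
    have hsub := norm_sub_sq (𝕜 := ℂ) v z
    simp only [RCLike.re_to_complex] at hadd hsub
    rw [show ‖v + z‖ ^ 4 = (‖v + z‖ ^ 2) ^ 2 by ring, show ‖v - z‖ ^ 4 = (‖v - z‖ ^ 2) ^ 2 by ring,
      hadd, hsub]
    ring
  have hre : (⟪v, Complex.I • w⟫_ℂ).re = -(⟪v, w⟫_ℂ).im := by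
    rw [inner_smul_right, Complex.I_mul_re]
  have hnorm : ‖Complex.I • w‖ = ‖w‖ := by
    rw [norm_smul, Complex.norm_I, one_mul]
  have hpair_I := hpair (Complex.I • w)
  rw [hre, hnorm] at hpair_I
  rw [Complex.sq_norm, Complex.normSq_apply]
  linear_combination hpair w + hpair_I

variable {E : Type*} [NormedAddCommGroup E] [InnerProductSpace ℂ E]

theorem norm_inner_sq_mul_norm_inner_sq_eq (v w x : E) :
    ‖⟪v, x⟫_ℂ‖ ^ 2 * ‖⟪w, x⟫_ℂ‖ ^ 2 =
      1 / 16 * (‖⟪v + w, x⟫_ℂ‖ ^ 4 + ‖⟪v - w, x⟫_ℂ‖ ^ 4 + ‖⟪v + Complex.I • w, x⟫_ℂ‖ ^ 4 +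
        ‖⟪v - Complex.I • w, x⟫_ℂ‖ ^ 4 - 4 * ‖⟪v, x⟫_ℂ‖ ^ 4 - 4 * ‖⟪w, x⟫_ℂ‖ ^ 4) := by
  have h := sum_norm_pow_four_eq ⟪x, v⟫_ℂ ⟪x, w⟫_ℂ
  simp only [← inner_smul_right, ← inner_add_right, ← inner_sub_right, smul_eq_mul,
    RCLike.inner_apply, norm_mul, RCLike.norm_conj, norm_inner_symm x] at h
  linear_combination -(1 / 16) * h

variable [FiniteDimensional ℂ E] [MeasurableSpace E] [BorelSpace E] [Nontrivial E]
  (μ : Measure E) [μ.IsAddHaarMeasure]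

theorem average_toSphere_inner_sq_mul_inner_sq (v w : E) :
    ⨍ u, ‖⟪v, u.1⟫_ℂ‖ ^ 2 * ‖⟪w, u.1⟫_ℂ‖ ^ 2 ∂μ.toSphere =
      (‖v‖ ^ 2 * ‖w‖ ^ 2 + ‖⟪v, w⟫_ℂ‖ ^ 2) / (finrank ℂ E * (finrank ℂ E + 1)) := by
  have hfourth (x : E) : ⨍ u, ‖⟪x, u.1⟫_ℂ‖ ^ 4 ∂μ.toSphere =
      2 / (finrank ℂ E * (finrank ℂ E + 1)) * ‖x‖ ^ 4 := by
    have h := average_toSphere_inner_pow μ x 2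
    rw [Nat.multichoose_eq, show finrank ℂ E + 2 - 1 = finrank ℂ E + 1 by omega,
      Nat.cast_choose_two] at h
    rw [h]
    push_cast
    field_simp
    ring
  simp_rw [norm_inner_sq_mul_norm_inner_sq_eq v w]
  rw [average, integral_const_mul, integral_sub, integral_sub, integral_add, integral_add,
    integral_add, integral_const_mul, integral_const_mul]
  · simp only [average] at hfourth
    simp_rw [hfourth]
    linear_combination (1 / 8 * (1 / (finrank ℂ E * (finrank ℂ E + 1)))) * sum_norm_pow_four_eq v w
  all_goals exact integrable_of_continuous (by fun_prop)

theorem succ_mul_mul_pow_le {a b : ℝ} (ha : 0 ≤ a) (hb : 0 ≤ b) (k : ℕ) :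
    (k + 1) * (a * b ^ k) ≤ a ^ (k + 1) + k * b ^ (k + 1) := by
  induction k with
  | zero => simp
  | succ k ih =>
    have hmono : 0 ≤ (a ^ (k + 1) - b ^ (k + 1)) * (a - b) := by
      rcases le_total a b with h | h
      · exact mul_nonneg_of_nonpos_of_nonpos (sub_nonpos.2 (pow_le_pow_left₀ ha h _))
          (sub_nonpos.2 h)
      · exact mul_nonneg (sub_nonneg.2 (pow_le_pow_left₀ hb h _)) (sub_nonneg.2 h)
    push_cast
    linear_combination b * ih + hmono

theorem average_toSphere_inner_sq_mul_inner_pow_le {v w : E} (hv : ‖v‖ = 1) (hw : ‖w‖ = 1)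
    (k : ℕ) :
    ⨍ u, ‖⟪v, u.1⟫_ℂ‖ ^ 2 * ‖⟪w, u.1⟫_ℂ‖ ^ (2 * k) ∂μ.toSphere ≤
      1 / (finrank ℂ E).multichoose (k + 1) := by
  have hpow (a b : ℝ) : a ^ 2 * b ^ (2 * k) ≤
      1 / (k + 1) * (a ^ (2 * (k + 1)) + k * b ^ (2 * (k + 1))) := by
    rw [one_div, le_inv_mul_iff₀ (by positivity)]
    simpa only [pow_mul] using succ_mul_mul_pow_le (sq_nonneg a) (sq_nonneg b) k
  have hmoment {x : E} (hx : ‖x‖ = 1) := average_toSphere_inner_pow μ x (k + 1)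
  simp only [average] at hmoment ⊢
  calc
    _ ≤ ∫ u, 1 / ((k : ℝ) + 1) * (‖⟪v, u.1⟫_ℂ‖ ^ (2 * (k + 1)) +
          k * ‖⟪w, u.1⟫_ℂ‖ ^ (2 * (k + 1))) ∂(μ.toSphere Set.univ)⁻¹ • μ.toSphere :=
      integral_mono (integrable_of_continuous (by fun_prop))
        (integrable_of_continuous (by fun_prop)) fun u => hpow _ _
    _ = _ := by
      rw [integral_const_mul, integral_add (integrable_of_continuous (by fun_prop))
        (integrable_of_continuous (by fun_prop)), integral_const_mul, hmoment hv, hmoment hw,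
        hv, hw, one_pow]
      field_simp
      ring

end Design

section Bernstein

variable {Ω : Type*} [MeasurableSpace Ω] {μ : Measure Ω} {X : Ω → ℝ}

theorem integral_norm_pow_div_factorial_mul_le {k : ℕ} (hmom : ∫ ω, |X ω| ^ k ∂μ ≤ (k + 1)!)
    (s : ℝ) : ∫ ω, ‖s ^ k / k ! * X ω ^ k‖ ∂μ ≤ (k + 1) * |s| ^ k := by
  simp only [norm_mul, norm_div, norm_pow, norm_eq_abs, Nat.abs_cast, integral_const_mul]
  calc
    _ ≤ |s| ^ k / k ! * (k + 1)! := by gcongr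
    _ = (k + 1) * |s| ^ k := by rw [Nat.factorial_succ]; push_cast; field_simp

theorem hasSum_mgf_of_moments_le (hint : ∀ k : ℕ, Integrable (fun ω => X ω ^ k) μ)
    (hmom : ∀ k : ℕ, ∫ ω, |X ω| ^ k ∂μ ≤ (k + 1)!) {s : ℝ} (hs : |s| < 1) :
    HasSum (fun k : ℕ => ∫ ω, s ^ k / k ! * X ω ^ k ∂μ) (mgf X μ s) := by
  have hsummable : Summable fun k : ℕ => ((k : ℝ) + 1) * |s| ^ k := by
    simpa using summable_choose_mul_geometric_of_norm_lt_one 1 (by simpa using hs)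
  have hsum := hasSum_integral_of_summable_integral_norm
    (fun k => (hint k).const_mul (s ^ k / k !))
    (hsummable.of_nonneg_of_le (fun k => integral_nonneg fun ω => norm_nonneg _)
      fun k => integral_norm_pow_div_factorial_mul_le (hmom k) s)
  have hexp (ω : Ω) : ∑' k : ℕ, s ^ k / k ! * X ω ^ k = exp (s * X ω) := by
    rw [exp_eq_exp_ℝ, NormedSpace.exp_eq_tsum_div]
    simp_rw [mul_pow, div_mul_eq_mul_div]
  simpa only [mgf, hexp] using hsum

theorem mgf_le_of_moments_le [IsProbabilityMeasure μ]
    (hint : ∀ k : ℕ, Integrable (fun ω => X ω ^ k) μ)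
    (hmom : ∀ k : ℕ, ∫ ω, |X ω| ^ k ∂μ ≤ (k + 1)!) {s : ℝ} (hs : |s| < 1) :
    mgf X μ s ≤ exp (s * ∫ ω, X ω ∂μ + 3 * s ^ 2 / (1 - |s|) ^ 2) := by
  have hgeom : HasSum (fun k : ℕ => ((k : ℝ) + 1) * |s| ^ k) (1 / (1 - |s|) ^ 2) := by
    simpa using hasSum_choose_mul_geometric_of_norm_lt_one 1 (r := |s|) (by simpa using hs)
  have hterm (k : ℕ) : ∫ ω, s ^ k / k ! * X ω ^ k ∂μ ≤ (k + 1) * |s| ^ k :=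
    (le_norm_self _).trans ((norm_integral_le_integral_norm _).trans
      (integral_norm_pow_div_factorial_mul_le (hmom k) s))
  have htail := hasSum_le (fun k => hterm (k + 2))
    ((hasSum_nat_add_iff' 2).2 (hasSum_mgf_of_moments_le hint hmom hs))
    ((hasSum_nat_add_iff' 2).2 hgeom)
  simp only [Finset.sum_range_succ, Finset.sum_range_zero, pow_zero, pow_one, Nat.factorial_zero,
    Nat.factorial_one, Nat.cast_zero, Nat.cast_one, div_one, zero_add, integral_const,
    integral_const_mul, probReal_univ, smul_eq_mul, mul_one] at htail
  have hremainder : 1 / (1 - |s|) ^ 2 - (1 + (1 + 1) * |s|) ≤ 3 * s ^ 2 / (1 - |s|) ^ 2 := by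
    have hpos : 0 < (1 - |s|) ^ 2 := pow_pos (sub_pos.2 hs) 2
    rw [← sq_abs s, sub_le_iff_le_add, div_add' _ _ _ hpos.ne', div_le_div_iff_of_pos_right hpos]
    linear_combination 2 * pow_nonneg (abs_nonneg s) 3
  linarith [add_one_le_exp (s * ∫ ω, X ω ∂μ + 3 * s ^ 2 / (1 - |s|) ^ 2)]

variable {ι : Type*} [Fintype ι] [IsProbabilityMeasure μ]

theorem measureReal_pi_le_sum_le {s v τ : ℝ} (hs : 0 ≤ s)
    (hint : Integrable (fun ω => exp (s * X ω)) μ) (hmgf : mgf X μ s ≤ exp v) :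
    (Measure.pi fun _ : ι => μ).real {ω | τ ≤ ∑ i, X (ω i)} ≤
      exp (Fintype.card ι * v - s * τ) := by
  have hprod (ω : ι → Ω) : exp (s * ∑ i, X (ω i)) = ∏ i, exp (s * X (ω i)) := by
    rw [Finset.mul_sum, exp_sum]
  have hsum : mgf (fun ω : ι → Ω => ∑ i, X (ω i)) (Measure.pi fun _ : ι => μ) s =
      mgf X μ s ^ Fintype.card ι := by
    simp_rw [mgf, hprod]
    exact integral_fintype_prod_eq_pow (fun ω => exp (s * X ω))
  calc
    _ ≤ exp (-s * τ) * mgf (fun ω : ι → Ω => ∑ i, X (ω i)) (Measure.pi fun _ : ι => μ) s := by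
      refine measure_ge_le_exp_mul_mgf τ hs ?_
      simp_rw [hprod]
      exact Integrable.fintype_prod fun _ => hint
    _ ≤ exp (-s * τ) * exp v ^ Fintype.card ι := by
      rw [hsum]
      gcongr
      exact mgf_nonneg
    _ = exp (Fintype.card ι * v - s * τ) := by
      rw [← exp_nat_mul, ← exp_add]
      ring_nf

theorem measureReal_pi_le_abs_sum_le {V b τ : ℝ} (hV : 0 < V)
    (hint : ∀ s, |s| ≤ b → Integrable (fun ω => exp (s * X ω)) μ)
    (hmgf : ∀ s, |s| ≤ b → mgf X μ s ≤ exp (V * s ^ 2)) (hτ : 0 ≤ τ) (hτb : τ ≤ 2 * V * b) :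
    (Measure.pi fun _ : ι => μ).real {ω | Fintype.card ι * τ ≤ |∑ i, X (ω i)|} ≤
      2 * exp (-(Fintype.card ι * τ ^ 2 / (4 * V))) := by
  -- The exponent `V s² - s τ` is minimal at `s = τ / (2 V)`.
  set s := τ / (2 * V) with hs_def
  have hs : 0 ≤ s := by positivity
  have hsb : |s| ≤ b := by rwa [abs_of_nonneg hs, div_le_iff₀' (by positivity)]
  have hsb' : |-s| ≤ b := by rwa [abs_neg]
  have hupper := measureReal_pi_le_sum_le (ι := ι) (τ := Fintype.card ι * τ) hs
    (hint s hsb) (hmgf s hsb)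
  have hlower := measureReal_pi_le_sum_le (ι := ι) (X := -X) (τ := Fintype.card ι * τ) hs
    (by simpa using hint (-s) hsb') (by simpa [mgf_neg] using hmgf (-s) hsb')
  have hexponent : Fintype.card ι * (V * s ^ 2) - s * (Fintype.card ι * τ) =
      -(Fintype.card ι * τ ^ 2 / (4 * V)) := by
    rw [hs_def]
    field_simp
    ring
  rw [hexponent] at hupper hlower
  rw [two_mul]
  refine (measureReal_mono fun ω hω => ?_).trans
    ((measureReal_union_le _ _).trans (add_le_add hupper hlower))
  simpa [le_abs] using hω

end Bernstein

section Nets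

variable {E : Type*} [NormedAddCommGroup E] [NormedSpace ℝ E] [FiniteDimensional ℝ E]

open scoped Function in
theorem card_le_of_isSeparated {ε : ℝ≥0} (hε : 0 < ε) {s : Finset E}
    (hs : (s : Set E) ⊆ closedBall 0 1) (hsep : IsSeparated ε (s : Set E)) :
    (s.card : ℝ) ≤ (1 + 2 / ε) ^ finrank ℝ E := by
  borelize E
  let μ : Measure E := Measure.addHaar
  have hε' : (0 : ℝ) < ε := hε
  have hdisj : Set.Pairwise (s : Set E) (Disjoint on fun c => ball c (ε / 2 : ℝ)) := by
    intro c hc e he hce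
    have hlt : (ε : ℝ≥0∞) < edist c e := hsep hc he hce
    rw [edist_nndist, ENNReal.coe_lt_coe, ← NNReal.coe_lt_coe, coe_nndist] at hlt
    exact ball_disjoint_ball (by linarith)
  have hsub : ⋃ c ∈ s, ball c (ε / 2 : ℝ) ⊆ ball 0 (1 + ε / 2 : ℝ) :=
    Set.iUnion₂_subset fun c hc => ball_subset_ball' (by
      linarith [mem_closedBall.1 (hs (Finset.mem_coe.2 hc))])
  have hvol : s.card * (ENNReal.ofReal ((ε / 2) ^ finrank ℝ E) * μ (ball 0 1)) ≤
      ENNReal.ofReal ((1 + ε / 2) ^ finrank ℝ E) * μ (ball 0 1) := by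
    rw [← μ.addHaar_ball_of_pos 0 (by positivity : (0 : ℝ) < 1 + ε / 2)]
    refine le_of_eq_of_le ?_ (measure_mono hsub)
    rw [measure_biUnion_finset hdisj fun c _ => measurableSet_ball,
      Finset.sum_congr rfl fun c _ => μ.addHaar_ball_of_pos c (half_pos hε'),
      Finset.sum_const, nsmul_eq_mul]
  rw [← mul_assoc, ENNReal.mul_le_mul_iff_left (measure_ball_pos _ _ zero_lt_one).ne'
    measure_ball_lt_top.ne] at hvol
  have hcard := ENNReal.toReal_le_of_le_ofReal (by positivity) hvol
  rw [ENNReal.toReal_mul, ENNReal.toReal_natCast, ENNReal.toReal_ofReal (by positivity),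
    ← le_div_iff₀ (by positivity), ← div_pow] at hcard
  rwa [show (1 + 2 / ε : ℝ) = (1 + ε / 2) / (ε / 2) by field_simp; ring]

theorem exists_finset_isCover_sphere (E : Type*) [NormedAddCommGroup E] [NormedSpace ℝ E]
    [FiniteDimensional ℝ E] {ε : ℝ≥0} (hε : 0 < ε) :
    ∃ s : Finset E, (s : Set E) ⊆ sphere 0 1 ∧ IsCover ε (sphere 0 1) (s : Set E) ∧
      (s.card : ℝ) ≤ (1 + 2 / ε) ^ finrank ℝ E := by
  have hpacking : packingNumber ε (sphere (0 : E) 1) ≠ ⊤ := by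
    obtain ⟨N, _, hNfin, hN⟩ :=
      exists_finite_isCover_of_isCompact (half_pos hε).ne' (isCompact_sphere (0 : E) 1)
    have h := (packingNumber_two_mul_le_externalCoveringNumber (ε / 2) _).trans
      hN.externalCoveringNumber_le_encard
    rw [mul_div_cancel₀ _ two_ne_zero] at h
    exact ne_top_of_le_ne_top hNfin.encard_lt_top.ne h
  have hfin : (maximalSeparatedSet ε (sphere (0 : E) 1)).Finite := by
    rw [← Set.encard_ne_top_iff, encard_maximalSeparatedSet hpacking]
    exact hpacking
  lift maximalSeparatedSet ε (sphere (0 : E) 1) to Finset E using hfin with s hs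
  have hsub : (s : Set E) ⊆ sphere 0 1 := hs ▸ maximalSeparatedSet_subset
  exact ⟨s, hsub, hs ▸ isCover_maximalSeparatedSet hpacking,
    card_le_of_isSeparated hε (hsub.trans sphere_subset_closedBall)
      (hs ▸ isSeparated_maximalSeparatedSet)⟩

end Nets

section OperatorNorm

variable {𝕜 E : Type*} [RCLike 𝕜] [NormedAddCommGroup E] [InnerProductSpace 𝕜 E] {T : E →L[𝕜] E}

theorem abs_reApplyInnerSelf_sub_le (T : E →L[𝕜] E) (x y : E) :
    |T.reApplyInnerSelf x - T.reApplyInnerSelf y| ≤ ‖T‖ * (‖x‖ + ‖y‖) * ‖x - y‖ := by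
  have hsplit : T.reApplyInnerSelf x - T.reApplyInnerSelf y =
      RCLike.re (inner 𝕜 (T (x - y)) x) + RCLike.re (inner 𝕜 (T y) (x - y)) := by
    simp only [T.reApplyInnerSelf_apply, map_sub, inner_sub_left, inner_sub_right]
    ring
  have hinner (a b : E) : |RCLike.re (inner 𝕜 (T a) b)| ≤ ‖T‖ * ‖a‖ * ‖b‖ :=
    (RCLike.abs_re_le_norm _).trans ((norm_inner_le_norm _ _).trans (by
      gcongr
      exact T.le_opNorm a))
  rw [hsplit]
  linarith [abs_add_le (RCLike.re (inner 𝕜 (T (x - y)) x)) (RCLike.re (inner 𝕜 (T y) (x - y))),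
    hinner (x - y) x, hinner y (x - y)]

theorem norm_le_of_abs_reApplyInnerSelf_le (hT : T.IsSymmetric) {c : ℝ} (hc : 0 ≤ c)
    (h : ∀ x, ‖x‖ = 1 → |T.reApplyInnerSelf x| ≤ c) : ‖T‖ ≤ c := by
  rw [T.norm_eq_iSup_rayleighQuotient hT]
  refine Real.iSup_le (fun x => ?_) hc
  rcases eq_or_ne x 0 with rfl | hx
  · simpa only [T.rayleighQuotient_apply_zero, abs_zero] using hc
  · have hnorm : ‖((‖x‖⁻¹ : ℝ) : 𝕜) • x‖ = 1 := by
      rw [norm_smul, RCLike.norm_ofReal, abs_of_nonneg (by positivity),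
        inv_mul_cancel₀ (norm_ne_zero_iff.2 hx)]
    rw [← T.rayleigh_smul x (c := ((‖x‖⁻¹ : ℝ) : 𝕜)) (by simpa using hx),
      ContinuousLinearMap.rayleighQuotient, hnorm, one_pow, div_one]
    exact h _ hnorm

theorem norm_le_of_isCover_sphere (hT : T.IsSymmetric) {ε : ℝ≥0} {s : Set E}
    (hs : s ⊆ sphere 0 1) (hcover : IsCover ε (sphere 0 1) s) {c : ℝ} (hc : 0 ≤ c)
    (h : ∀ x ∈ s, |T.reApplyInnerSelf x| ≤ c) : ‖T‖ ≤ c + 2 * ε * ‖T‖ := by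
  refine norm_le_of_abs_reApplyInnerSelf_le hT (by positivity) fun x hx => ?_
  obtain ⟨y, hy, hdist⟩ := Set.mem_iUnion₂.1
    (isCover_iff_subset_iUnion_closedBall.1 hcover (mem_sphere_zero_iff_norm.2 hx))
  rw [mem_closedBall, dist_eq_norm] at hdist
  have hlip := abs_reApplyInnerSelf_sub_le T x y
  rw [hx, mem_sphere_zero_iff_norm.1 (hs hy)] at hlip
  linarith [abs_sub_abs_le_abs_sub (T.reApplyInnerSelf x) (T.reApplyInnerSelf y), h y hy,
    mul_le_mul_of_nonneg_left hdist (norm_nonneg T)]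

end OperatorNorm

section QuadForm

variable {d : ℕ}

/-- The quadratic form `re ⟨M x, x⟩` of a matrix `M` at the vector `x`, as a linear functional of
`M`. -/
noncomputable def quadForm (x : EuclideanSpace ℂ (Fin d)) : Matrix (Fin d) (Fin d) ℂ →ₗ[ℝ] ℝ where
  toFun M := (Matrix.toEuclideanCLM (n := Fin d) (𝕜 := ℂ) M).reApplyInnerSelf x
  map_add' M N := by
    simp only [map_add, ContinuousLinearMap.reApplyInnerSelf_apply, add_apply, inner_add_left]
  map_smul' c M := by
    simp only [← Complex.coe_smul, map_smul, ContinuousLinearMap.reApplyInnerSelf_apply,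
      smul_apply, inner_smul_left, Complex.conj_ofReal, RCLike.re_to_complex,
      Complex.re_ofReal_mul, RingHom.id_apply, smul_eq_mul]

theorem quadForm_one (x : EuclideanSpace ℂ (Fin d)) : quadForm x 1 = ‖x‖ ^ 2 := by
  simp only [quadForm, LinearMap.coe_mk, AddHom.coe_mk, map_one,
    ContinuousLinearMap.reApplyInnerSelf_apply, one_apply_eq_self, inner_self_eq_norm_sq]

theorem toEuclideanCLM_ketbra_apply (u : PureState d) (x : EuclideanSpace ℂ (Fin d)) :
    Matrix.toEuclideanCLM (n := Fin d) (𝕜 := ℂ) (ketbra u) x = ⟪u.1, x⟫_ℂ • u.1 := by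
  ext i
  rw [Matrix.ofLp_toEuclideanCLM, ketbra, Matrix.vecMulVec_mulVec,
    EuclideanSpace.inner_eq_star_dotProduct, dotProduct_comm]
  exact mul_comm _ _

theorem quadForm_ketbra (u : PureState d) (x : EuclideanSpace ℂ (Fin d)) :
    quadForm x (ketbra u) = ‖⟪x, u.1⟫_ℂ‖ ^ 2 := by
  simp only [quadForm, LinearMap.coe_mk, AddHom.coe_mk,
    ContinuousLinearMap.reApplyInnerSelf_apply, toEuclideanCLM_ketbra_apply, inner_smul_left,
    inner_conj_symm, inner_mul_symm_re_eq_norm, norm_mul, norm_inner_symm u.1 x, sq]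

theorem trace_ketbra_mul_re (u : PureState d) (M : Matrix (Fin d) (Fin d) ℂ) :
    (ketbra u * M).trace.re = quadForm u.1 M := by
  have h : (ketbra u * M).trace = ⟪u.1, Matrix.toEuclideanCLM (n := Fin d) (𝕜 := ℂ) M u.1⟫_ℂ := by
    rw [ketbra, Matrix.vecMulVec_mul, Matrix.trace_vecMulVec, dotProduct_comm,
      ← Matrix.dotProduct_mulVec, EuclideanSpace.inner_eq_star_dotProduct, dotProduct_comm,
      Matrix.ofLp_toEuclideanCLM]
    rfl
  rw [h, ← Complex.conj_re, inner_conj_symm]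
  rfl

theorem toEuclideanCLM_eigenvectorBasis {A : Matrix (Fin d) (Fin d) ℂ} (hA : A.IsHermitian)
    (j : Fin d) : Matrix.toEuclideanCLM (n := Fin d) (𝕜 := ℂ) A (hA.eigenvectorBasis j) =
      (hA.eigenvalues j : ℂ) • hA.eigenvectorBasis j := by
  apply WithLp.ofLp_injective
  rw [Matrix.ofLp_toEuclideanCLM, hA.mulVec_eigenvectorBasis, Complex.coe_smul, WithLp.ofLp_smul]

theorem isSymmetric_toEuclideanCLM {A : Matrix (Fin d) (Fin d) ℂ} (hA : A.IsHermitian) :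
    (Matrix.toEuclideanCLM (n := Fin d) (𝕜 := ℂ) A).IsSymmetric :=
  Matrix.isSymmetric_toEuclideanLin_iff.2 hA

theorem quadForm_eq_sum_eigenvalues {A : Matrix (Fin d) (Fin d) ℂ} (hA : A.IsHermitian)
    (x : EuclideanSpace ℂ (Fin d)) :
    quadForm x A = ∑ j, hA.eigenvalues j * ‖⟪hA.eigenvectorBasis j, x⟫_ℂ‖ ^ 2 := by
  change (⟪Matrix.toEuclideanCLM (n := Fin d) (𝕜 := ℂ) A x, x⟫_ℂ).re = _
  rw [← hA.eigenvectorBasis.sum_inner_mul_inner, Complex.re_sum]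
  refine Finset.sum_congr rfl fun j _ => ?_
  have hsymm := isSymmetric_toEuclideanCLM hA x (hA.eigenvectorBasis j)
  simp only [ContinuousLinearMap.coe_coe, toEuclideanCLM_eigenvectorBasis, inner_smul_right]
    at hsymm
  rw [hsymm, mul_assoc, Complex.re_ofReal_mul, ← RCLike.re_to_complex,
    inner_mul_symm_re_eq_norm, norm_mul, norm_inner_symm x, sq]

end QuadForm

section Outcome

variable {d : ℕ} {ρ : Matrix (Fin d) (Fin d) ℂ}

theorem IsDensityMatrix.neZero (hρ : IsDensityMatrix ρ) : NeZero d := ⟨by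
  rintro rfl
  simpa [Matrix.trace] using hρ.trace_eq_one⟩

theorem IsDensityMatrix.isHermitian (hρ : IsDensityMatrix ρ) : ρ.IsHermitian :=
  hρ.posSemidef.isHermitian

theorem IsDensityMatrix.sum_eigenvalues (hρ : IsDensityMatrix ρ) :
    ∑ j, hρ.isHermitian.eigenvalues j = 1 := by
  have h := hρ.isHermitian.trace_eq_sum_eigenvalues
  rw [hρ.trace_eq_one] at h
  exact_mod_cast (congrArg Complex.re h).symm

theorem integral_uniformPOVM (hρ : IsDensityMatrix ρ) {g : PureState d → ℝ} (hg : Continuous g) :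
    ∫ u, g u ∂uniformPOVM ρ = ∑ j, hρ.isHermitian.eigenvalues j *
      (d * ⨍ u, ‖⟪hρ.isHermitian.eigenvectorBasis j, u.1⟫_ℂ‖ ^ 2 * g u
        ∂(volume : Measure (EuclideanSpace ℂ (Fin d))).toSphere) := by
  have := hρ.neZero
  have hnonneg (u : PureState d) : 0 ≤ (d : ℝ) * ∑ j, hρ.isHermitian.eigenvalues j *
      ‖⟪hρ.isHermitian.eigenvectorBasis j, u.1⟫_ℂ‖ ^ 2 :=
    mul_nonneg d.cast_nonneg (Finset.sum_nonneg fun j _ =>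
      mul_nonneg (hρ.posSemidef.eigenvalues_nonneg j) (sq_nonneg _))
  simp_rw [uniformPOVM, trace_ketbra_mul_re,
    quadForm_eq_sum_eigenvalues hρ.isHermitian]
  rw [integral_withDensity_eq_integral_toReal_smul
    (by fun_prop) (.of_forall fun u => ENNReal.ofReal_lt_top)]
  simp_rw [ENNReal.toReal_ofReal (hnonneg _), smul_eq_mul, Finset.mul_sum, Finset.sum_mul]
  rw [haarPure, integral_finsetSum _ fun j _ => integrable_of_continuous (by fun_prop)]
  refine Finset.sum_congr rfl fun j _ => ?_
  rw [average, ← integral_const_mul, ← integral_const_mul]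
  congr 1
  ext u
  ring

theorem isProbabilityMeasure_uniformPOVM (hρ : IsDensityMatrix ρ) :
    IsProbabilityMeasure (uniformPOVM ρ) := by
  have := hρ.neZero
  have hmass (j : Fin d) :
      (d : ℝ) * ⨍ u, ‖⟪hρ.isHermitian.eigenvectorBasis j, u.1⟫_ℂ‖ ^ 2 * 1
        ∂(volume : Measure (EuclideanSpace ℂ (Fin d))).toSphere = 1 := by
    have h := average_toSphere_inner_pow (volume : Measure (EuclideanSpace ℂ (Fin d)))
      (hρ.isHermitian.eigenvectorBasis j) 1
    simp only [mul_one, OrthonormalBasis.norm_eq_one, one_pow, finrank_euclideanSpace_fin,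
      Nat.multichoose_one_right] at h ⊢
    rw [h, mul_one_div_cancel (Nat.cast_ne_zero.2 (NeZero.ne d))]
  have h := integral_uniformPOVM hρ (g := fun _ => 1) continuous_const
  simp_rw [hmass, mul_one, hρ.sum_eigenvalues, integral_const, smul_eq_mul, mul_one] at h
  exact ⟨(ENNReal.toReal_eq_one_iff _).1 h⟩

theorem isProbabilityMeasure_uniformPOVMCopies (hρ : IsDensityMatrix ρ) (n : ℕ) :
    IsProbabilityMeasure (uniformPOVMCopies ρ n) := by
  have := isProbabilityMeasure_uniformPOVM hρ
  exact inferInstanceAs (IsProbabilityMeasure (Measure.pi fun _ => uniformPOVM ρ))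

theorem integral_uniformPOVM_inner_sq (hρ : IsDensityMatrix ρ) {v : EuclideanSpace ℂ (Fin d)}
    (hv : ‖v‖ = 1) :
    ∫ u, (d + 1) * ‖⟪v, u.1⟫_ℂ‖ ^ 2 ∂uniformPOVM ρ = 1 + quadForm v ρ := by
  have := hρ.neZero
  have hd : (d : ℝ) ≠ 0 := Nat.cast_ne_zero.2 (NeZero.ne d)
  rw [integral_const_mul, integral_uniformPOVM hρ (by fun_prop)]
  simp_rw [average_toSphere_inner_sq_mul_inner_sq, finrank_euclideanSpace_fin,
    OrthonormalBasis.norm_eq_one, hv]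
  calc
    _ = ∑ j, hρ.isHermitian.eigenvalues j *
        (1 + ‖⟪hρ.isHermitian.eigenvectorBasis j, v⟫_ℂ‖ ^ 2) := by
      rw [Finset.mul_sum]
      refine Finset.sum_congr rfl fun j _ => ?_
      field_simp
    _ = 1 + quadForm v ρ := by
      simp_rw [mul_add, mul_one, Finset.sum_add_distrib, hρ.sum_eigenvalues,
        quadForm_eq_sum_eigenvalues hρ.isHermitian]

theorem mul_succ_pow_le_factorial_mul_multichoose (d k : ℕ) :
    d * (d + 1) ^ k ≤ (k + 1)! * d.multichoose (k + 1) := by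
  rw [Nat.multichoose_eq, ← Nat.ascFactorial_eq_factorial_mul_choose']
  induction k with
  | zero => simp [Nat.ascFactorial]
  | succ k ih =>
    rw [pow_succ', Nat.ascFactorial_succ, mul_left_comm]
    exact Nat.mul_le_mul (by omega) ih

theorem integral_uniformPOVM_inner_pow_le (hρ : IsDensityMatrix ρ)
    {v : EuclideanSpace ℂ (Fin d)} (hv : ‖v‖ = 1) (k : ℕ) :
    ∫ u, ((d + 1) * ‖⟪v, u.1⟫_ℂ‖ ^ 2) ^ k ∂uniformPOVM ρ ≤ ((k + 1)! : ℝ) := by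
  have := hρ.neZero
  have hchoose : (0 : ℝ) < d.multichoose (k + 1) := by
    rw [Nat.multichoose_eq]
    exact_mod_cast Nat.choose_pos (by have := NeZero.pos d; omega)
  have hbound (j : Fin d) :
      (d : ℝ) * ⨍ u, ‖⟪hρ.isHermitian.eigenvectorBasis j, u.1⟫_ℂ‖ ^ 2 *
        ((d + 1) * ‖⟪v, u.1⟫_ℂ‖ ^ 2) ^ k
          ∂(volume : Measure (EuclideanSpace ℂ (Fin d))).toSphere ≤ ((k + 1)! : ℝ) := by
    have h := average_toSphere_inner_sq_mul_inner_pow_le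
      (volume : Measure (EuclideanSpace ℂ (Fin d)))
      (hρ.isHermitian.eigenvectorBasis.norm_eq_one j) hv k
    rw [finrank_euclideanSpace_fin] at h
    simp_rw [mul_pow, ← pow_mul, mul_left_comm _ (((d : ℝ) + 1) ^ k)]
    rw [average, integral_const_mul]
    calc
      _ ≤ (d : ℝ) * ((d + 1) ^ k * (1 / d.multichoose (k + 1))) := by gcongr; exact h
      _ ≤ (k + 1)! := by
        rw [mul_one_div, mul_div_assoc', div_le_iff₀ hchoose]
        exact_mod_cast mul_succ_pow_le_factorial_mul_multichoose d k
  rw [integral_uniformPOVM hρ (by fun_prop)]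
  calc
    _ ≤ ∑ j, hρ.isHermitian.eigenvalues j * ((k + 1)! : ℝ) :=
      Finset.sum_le_sum fun j _ =>
        mul_le_mul_of_nonneg_left (hbound j) (hρ.posSemidef.eigenvalues_nonneg j)
    _ = (k + 1)! := by rw [← Finset.sum_mul, hρ.sum_eigenvalues, one_mul]

theorem mgf_uniformPOVM_le (hρ : IsDensityMatrix ρ) {v : EuclideanSpace ℂ (Fin d)}
    (hv : ‖v‖ = 1) {s : ℝ} (hs : |s| ≤ 1 / 4) :
    mgf (fun u => (d + 1) * ‖⟪v, u.1⟫_ℂ‖ ^ 2 - (1 + quadForm v ρ)) (uniformPOVM ρ) s ≤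
      exp (6 * s ^ 2) := by
  have := isProbabilityMeasure_uniformPOVM hρ
  have h := mgf_le_of_moments_le (μ := uniformPOVM ρ)
    (X := fun u => (d + 1) * ‖⟪v, u.1⟫_ℂ‖ ^ 2) (s := s)
    (fun k => integrable_of_continuous (by fun_prop))
    (fun k => by
      simp_rw [abs_of_nonneg (by positivity : 0 ≤ (d + 1) * ‖⟪v, _⟫_ℂ‖ ^ 2)]
      exact integral_uniformPOVM_inner_pow_le hρ hv k)
    (hs.trans_lt (by norm_num))
  rw [integral_uniformPOVM_inner_sq hρ hv] at h
  have hvariance : 3 * s ^ 2 / (1 - |s|) ^ 2 ≤ 6 * s ^ 2 := by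
    have hgap : 1 / 2 ≤ (1 - |s|) ^ 2 := by nlinarith
    rw [div_le_iff₀ (by linarith)]
    nlinarith [sq_nonneg s]
  simp_rw [sub_eq_add_neg, mgf_add_const]
  calc
    _ ≤ exp (s * (1 + quadForm v ρ) + 3 * s ^ 2 / (1 - |s|) ^ 2) *
        exp (s * -(1 + quadForm v ρ)) := by gcongr
    _ = exp (3 * s ^ 2 / (1 - |s|) ^ 2) := by rw [← exp_add]; ring_nf
    _ ≤ exp (6 * s ^ 2) := exp_le_exp.2 hvariance

end Outcome

section Estimate

variable {d n : ℕ} {ρ : Matrix (Fin d) (Fin d) ℂ} {v : EuclideanSpace ℂ (Fin d)}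

theorem estimate_eq_smul_sum (u : Fin n → PureState d) :
    estimate u = (n : ℝ)⁻¹ • ∑ i, (((d : ℝ) + 1) • ketbra (u i) - 1) := by
  simp only [estimate, ← Complex.coe_smul, one_div]
  push_cast
  rfl

theorem natCast_mul_quadForm_estimate_sub (u : Fin n → PureState d) (hv : ‖v‖ = 1)
    (ρ : Matrix (Fin d) (Fin d) ℂ) :
    n * quadForm v (estimate u - ρ) =
      ∑ i, ((d + 1) * ‖⟪v, (u i).1⟫_ℂ‖ ^ 2 - (1 + quadForm v ρ)) := by
  rcases eq_or_ne n 0 with rfl | hn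
  · simp
  · simp only [estimate_eq_smul_sum, map_sub, map_smul, map_sum, quadForm_ketbra, quadForm_one, hv,
      smul_eq_mul, one_pow, ← sub_sub]
    rw [Finset.sum_sub_distrib _ fun _ => quadForm v ρ, mul_sub,
      mul_inv_cancel_left₀ (Nat.cast_ne_zero.2 hn)]
    simp

theorem measureReal_le_abs_quadForm_estimate_sub_le (hρ : IsDensityMatrix ρ) (hv : ‖v‖ = 1)
    (n : ℕ) {τ : ℝ} (hτ : 0 ≤ τ) (hτ' : τ ≤ 3) :
    (uniformPOVMCopies ρ n).real {u | τ ≤ |quadForm v (estimate u - ρ)|} ≤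
      2 * exp (-(n * τ ^ 2 / 24)) := by
  have := isProbabilityMeasure_uniformPOVM hρ
  have := isProbabilityMeasure_uniformPOVMCopies hρ n
  have h := measureReal_pi_le_abs_sum_le (ι := Fin n) (μ := uniformPOVM ρ) (b := 1 / 4)
    (by norm_num : (0 : ℝ) < 6) (fun s _ => integrable_of_continuous (by fun_prop))
    (fun s hs => mgf_uniformPOVM_le hρ hv hs) hτ (by linarith)
  rw [Fintype.card_fin, show (4 * 6 : ℝ) = 24 by norm_num] at h
  refine (measureReal_mono fun u hu => ?_).trans h
  rw [Set.mem_ofPred_eq, ← natCast_mul_quadForm_estimate_sub u hv ρ, abs_mul, Nat.abs_cast]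
  exact mul_le_mul_of_nonneg_left hu n.cast_nonneg

end Estimate

section Concentration

theorem exists_finset_isCover_sphere_card_le_exp (d : ℕ) :
    ∃ s : Finset (EuclideanSpace ℂ (Fin d)), (s : Set (EuclideanSpace ℂ (Fin d))) ⊆ sphere 0 1 ∧
      IsCover (1 / 4) (sphere 0 1) (s : Set (EuclideanSpace ℂ (Fin d))) ∧
      (s.card : ℝ) ≤ exp (5 * d) := by
  obtain ⟨s, hs, hcover, hcard⟩ := exists_finset_isCover_sphere (EuclideanSpace ℂ (Fin d))
    (ε := 1 / 4) (by norm_num)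
  have hbase : (1 + 2 / (1 / 4)) ^ 2 ≤ exp 5 := by
    rw [show exp 5 = exp 1 ^ 5 by rw [← exp_nat_mul]; norm_num]
    exact le_trans (by norm_num) (pow_le_pow_left₀ (by norm_num) exp_one_gt_d9.le 5)
  refine ⟨s, hs, hcover, hcard.trans ?_⟩
  rw [finrank_real_of_complex, finrank_euclideanSpace_fin, pow_mul, mul_comm, exp_nat_mul]
  push_cast
  gcongr

variable {d : ℕ} {ρ : Matrix (Fin d) (Fin d) ℂ}

theorem continuous_estimate (n : ℕ) :
    Continuous (estimate : (Fin n → PureState d) → Matrix (Fin d) (Fin d) ℂ) := by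
  unfold estimate ketbra
  fun_prop

theorem measurableSet_opNorm_estimate_sub_le (ρ : Matrix (Fin d) (Fin d) ℂ) (n : ℕ) (τ : ℝ) :
    MeasurableSet {u : Fin n → PureState d | opNorm (estimate u - ρ) ≤ τ} := by
  have hcont : Continuous (opNorm : Matrix (Fin d) (Fin d) ℂ → ℝ) := by
    open scoped Matrix.Norms.L2Operator in exact continuous_norm
  exact (isClosed_le (hcont.comp ((continuous_estimate n).sub continuous_const))
    continuous_const).measurableSet

theorem measureReal_lt_opNorm_estimate_sub_le (hρ : IsDensityMatrix ρ) (n : ℕ) {τ : ℝ}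
    (hτ : 0 ≤ τ) (hτ' : τ ≤ 6) :
    (uniformPOVMCopies ρ n).real {u | τ < opNorm (estimate u - ρ)} ≤
      2 * exp (5 * d - n * τ ^ 2 / 96) := by
  have := isProbabilityMeasure_uniformPOVMCopies hρ n
  obtain ⟨s, hs, hcover, hcard⟩ := exists_finset_isCover_sphere_card_le_exp d
  have hsub : {u : Fin n → PureState d | τ < opNorm (estimate u - ρ)} ⊆
      ⋃ v ∈ s, {u | τ / 2 ≤ |quadForm v (estimate u - ρ)|} := by
    intro u hu
    by_contra hnot
    simp only [Set.mem_iUnion, Set.mem_ofPred_eq, not_exists, not_le] at hu hnot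
    have hnorm := norm_le_of_isCover_sphere
      (isSymmetric_toEuclideanCLM ((isHermitian_estimate u).sub hρ.isHermitian)) hs hcover
      (by positivity) fun v hv => (hnot v hv).le
    change opNorm _ ≤ _ + _ * opNorm _ at hnorm
    push_cast at hnorm
    linarith
  calc
    _ ≤ ∑ v ∈ s, (uniformPOVMCopies ρ n).real {u | τ / 2 ≤ |quadForm v (estimate u - ρ)|} :=
      (measureReal_mono hsub (measure_ne_top _ _)).trans
        (measureReal_biUnion_finset_le _ _)
    _ ≤ ∑ v ∈ s, 2 * exp (-(n * (τ / 2) ^ 2 / 24)) := Finset.sum_le_sum fun v hv =>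
      measureReal_le_abs_quadForm_estimate_sub_le hρ (mem_sphere_zero_iff_norm.1 (hs hv)) n
        (by positivity) (by linarith)
    _ = s.card * (2 * exp (-(n * τ ^ 2 / 96))) := by
      rw [Finset.sum_const, nsmul_eq_mul]
      ring_nf
    _ ≤ exp (5 * d) * (2 * exp (-(n * τ ^ 2 / 96))) := by gcongr
    _ = 2 * exp (5 * d - n * τ ^ 2 / 96) := by
      rw [mul_left_comm, ← exp_add, ← sub_eq_add_neg]

theorem le_uniformPOVMCopies_opNorm_estimate_sub_le (hρ : IsDensityMatrix ρ) {n : ℕ} {τ : ℝ}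
    (hτ : 0 ≤ τ) (hτ' : τ ≤ 6) (hn : 1056 * d ≤ n * τ ^ 2) :
    (99 / 100 : ℝ≥0∞) ≤ uniformPOVMCopies ρ n {u | opNorm (estimate u - ρ) ≤ τ} := by
  have := isProbabilityMeasure_uniformPOVMCopies hρ n
  have hd : (1 : ℝ) ≤ d := by exact_mod_cast hρ.neZero.one_le
  have hexp : 2 * exp (-6) ≤ 1 / 100 := by
    have h : (200 : ℝ) ≤ exp 1 ^ 6 :=
      le_trans (by norm_num) (pow_le_pow_left₀ (by norm_num) exp_one_gt_d9.le 6)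
    rw [exp_neg, show exp 6 = exp 1 ^ 6 by rw [← exp_nat_mul]; norm_num, ← div_eq_mul_inv,
      div_le_iff₀ (by positivity)]
    linarith
  have htail : (uniformPOVMCopies ρ n).real {u | opNorm (estimate u - ρ) ≤ τ}ᶜ ≤ 1 / 100 := by
    simp only [Set.compl_ofPred, not_le]
    calc
      _ ≤ 2 * exp (5 * d - n * τ ^ 2 / 96) := measureReal_lt_opNorm_estimate_sub_le hρ n hτ hτ'
      _ ≤ 2 * exp (-6) := by gcongr; linarith
      _ ≤ 1 / 100 := hexp
  rw [probReal_compl_eq_one_sub (measurableSet_opNorm_estimate_sub_le ρ n τ)] at htail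
  rw [← ENNReal.toReal_le_toReal (by finiteness) (measure_ne_top _ _), ← Measure.real,
    ENNReal.toReal_div]
  norm_num
  linarith

end Concentration

open scoped MatrixOrder Matrix.Norms.L2Operator

section Spectrum

variable {d : ℕ} {A A' : Matrix (Fin d) (Fin d) ℂ}

theorem quadForm_mono (h : A ≤ A') (x : EuclideanSpace ℂ (Fin d)) :
    quadForm x A ≤ quadForm x A' := by
  rw [← sub_nonneg, ← map_sub]
  have hdot := (Matrix.le_iff.1 h).re_dotProduct_nonneg x.ofLp
  rwa [dotProduct_comm, ← Matrix.ofLp_toEuclideanCLM, ← EuclideanSpace.inner_eq_star_dotProduct,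
    inner_re_symm] at hdot

theorem trace_re_mono (h : A ≤ A') : A.trace.re ≤ A'.trace.re :=
  (Complex.le_def.1 ((Matrix.tracePositiveLinearMap (Fin d) ℂ ℂ).monotone' h)).1

theorem exists_ne_zero_forall_ne_apply_eq_zero {K V ι : Type*} [Field K] [AddCommGroup V]
    [Module K V] [FiniteDimensional K V] [Fintype ι] (hι : Fintype.card ι ≤ finrank K V)
    (f : ι → Dual K V) (i : ι) : ∃ x, x ≠ 0 ∧ ∀ k ≠ i, f k x = 0 := by
  classical
  have hker : (LinearMap.pi fun k : {k // k ≠ i} => f k).ker ≠ ⊥ := by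
    refine LinearMap.ker_ne_bot_of_finrank_lt ?_
    rw [finrank_fintype_fun_eq_card]
    exact (Fintype.card_subtype_lt fun h => h rfl).trans_le hι
  obtain ⟨x, hx, hx0⟩ := Submodule.exists_mem_ne_zero_of_ne_bot hker
  exact ⟨x, hx0, fun k hk => congrFun (LinearMap.mem_ker.1 hx) ⟨k, hk⟩⟩

/-- The bijection between the index of an eigenvalue in `spec` and its index in Mathlib's
`Matrix.IsHermitian.eigenvalues`. -/
noncomputable def specEquiv (d : ℕ) : Fin d ≃ Fin d :=
  (finCongr (Fintype.card_fin d).symm).trans (Fintype.equivOfCardEq (Fintype.card_fin _))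

/-- An orthonormal eigenbasis of a Hermitian matrix, in the order of `spec`. -/
noncomputable def specBasis (hA : A.IsHermitian) :
    OrthonormalBasis (Fin d) ℂ (EuclideanSpace ℂ (Fin d)) :=
  hA.eigenvectorBasis.reindex (specEquiv d).symm

theorem spec_eq_eigenvalues (hA : A.IsHermitian) (i : Fin d) :
    spec hA i = hA.eigenvalues (specEquiv d i) := by
  simp [spec, Matrix.IsHermitian.eigenvalues, specEquiv]

theorem spec_antitone (hA : A.IsHermitian) : Antitone (spec hA) :=
  fun _ _ h => hA.eigenvalues₀_antitone h

theorem sum_spec (hA : A.IsHermitian) : ∑ i, spec hA i = A.trace.re := by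
  simp_rw [spec_eq_eigenvalues]
  rw [Equiv.sum_comp (specEquiv d) hA.eigenvalues, hA.trace_eq_sum_eigenvalues]
  exact_mod_cast rfl

theorem quadForm_eq_sum_spec (hA : A.IsHermitian) (x : EuclideanSpace ℂ (Fin d)) :
    quadForm x A = ∑ i, spec hA i * ‖⟪specBasis hA i, x⟫_ℂ‖ ^ 2 := by
  simp_rw [spec_eq_eigenvalues, specBasis, OrthonormalBasis.reindex_apply, Equiv.symm_symm]
  rw [quadForm_eq_sum_eigenvalues hA, Equiv.sum_comp (specEquiv d)
    fun j => hA.eigenvalues j * ‖⟪hA.eigenvectorBasis j, x⟫_ℂ‖ ^ 2]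

theorem spec_mul_norm_sq_le_quadForm (hA : A.IsHermitian) {x : EuclideanSpace ℂ (Fin d)}
    {i : Fin d} (hx : ∀ k, i < k → ⟪specBasis hA k, x⟫_ℂ = 0) :
    spec hA i * ‖x‖ ^ 2 ≤ quadForm x A := by
  rw [quadForm_eq_sum_spec hA, ← (specBasis hA).sum_sq_norm_inner_right, Finset.mul_sum]
  refine Finset.sum_le_sum fun k _ => ?_
  rcases lt_or_ge i k with hk | hk
  · simp [hx k hk]
  · gcongr
    exact spec_antitone hA hk

theorem quadForm_le_spec_mul_norm_sq (hA : A.IsHermitian) {x : EuclideanSpace ℂ (Fin d)}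
    {i : Fin d} (hx : ∀ k, k < i → ⟪specBasis hA k, x⟫_ℂ = 0) :
    quadForm x A ≤ spec hA i * ‖x‖ ^ 2 := by
  rw [quadForm_eq_sum_spec hA, ← (specBasis hA).sum_sq_norm_inner_right, Finset.mul_sum]
  refine Finset.sum_le_sum fun k _ => ?_
  rcases lt_or_ge k i with hk | hk
  · simp [hx k hk]
  · gcongr
    exact spec_antitone hA hk

theorem spec_le_spec_add_of_le_add (hA : A.IsHermitian) (hA' : A'.IsHermitian) {δ : ℝ}
    (h : A ≤ A' + algebraMap ℝ _ δ) (i : Fin d) : spec hA i ≤ spec hA' i + δ := by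
  -- A nonzero vector in the span of the top `i + 1` eigenvectors of `A` and of the bottom `d - i`
  -- eigenvectors of `A'`, which exists by counting dimensions, compares the two eigenvalues.
  obtain ⟨x, hx0, hx⟩ := exists_ne_zero_forall_ne_apply_eq_zero
    (V := EuclideanSpace ℂ (Fin d)) finrank_euclideanSpace.ge
    (fun k => innerₛₗ ℂ (if k < i then specBasis hA' k else specBasis hA k)) i
  have hlower := spec_mul_norm_sq_le_quadForm hA (x := x) (i := i) fun k hk => by
    simpa only [innerₛₗ_apply_apply, if_neg hk.not_gt] using hx k hk.ne'
  have hupper := quadForm_le_spec_mul_norm_sq hA' (x := x) (i := i) fun k hk => by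
    simpa only [innerₛₗ_apply_apply, if_pos hk] using hx k hk.ne
  have hmono := quadForm_mono h x
  rw [map_add, Algebra.algebraMap_eq_smul_one, map_smul, quadForm_one, smul_eq_mul] at hmono
  have hpos : 0 < ‖x‖ ^ 2 := by positivity
  exact le_of_mul_le_mul_right (by linarith) hpos

theorem spec_mono (hA : A.IsHermitian) (hA' : A'.IsHermitian) (h : A ≤ A') (i : Fin d) :
    spec hA i ≤ spec hA' i := by
  simpa only [add_zero] using
    spec_le_spec_add_of_le_add hA hA' (δ := 0) (by rwa [map_zero, add_zero]) i

theorem le_add_algebraMap_opNorm_sub (hA : A.IsHermitian) (hA' : A'.IsHermitian) :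
    A ≤ A' + algebraMap ℝ _ (opNorm (A - A')) :=
  sub_le_iff_le_add'.1 (hA.sub hA').isSelfAdjoint.le_algebraMap_norm_self

theorem opNorm_sub_comm (A A' : Matrix (Fin d) (Fin d) ℂ) : opNorm (A - A') = opNorm (A' - A) :=
  norm_sub_rev A A'

theorem abs_spec_sub_le (hA : A.IsHermitian) (hA' : A'.IsHermitian) (i : Fin d) :
    |spec hA i - spec hA' i| ≤ opNorm (A - A') := by
  have h := spec_le_spec_add_of_le_add hA hA' (le_add_algebraMap_opNorm_sub hA hA') i
  have h' := spec_le_spec_add_of_le_add hA' hA (le_add_algebraMap_opNorm_sub hA' hA) i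
  rw [opNorm_sub_comm] at h'
  exact abs_sub_le_iff.2 ⟨by linarith, by linarith⟩

theorem dTV_firstEntries_spec_le (hA : A.IsHermitian) (hA' : A'.IsHermitian) (r : ℕ)
    {δ : ℝ} (hδ : opNorm (A - A') ≤ δ) :
    dTV (firstEntries r (spec hA)) (firstEntries r (spec hA')) ≤ 1 / 2 * (r * δ) := by
  have hcard : Fintype.card {i : Fin d // (i : ℕ) < r} ≤ r := by
    simpa using Fintype.card_le_of_injective (fun i => (⟨i.1, i.2⟩ : Fin r))
      fun i j h => Subtype.ext (Fin.ext (Fin.mk.inj h))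
  rw [dTV]
  gcongr
  calc
    _ ≤ Fintype.card {i : Fin d // (i : ℕ) < r} • δ :=
      Finset.sum_le_card_nsmul _ _ _ fun i _ => (abs_spec_sub_le hA hA' i).trans hδ
    _ ≤ r * δ := by
      rw [nsmul_eq_mul]
      exact mul_le_mul_of_nonneg_right (mod_cast hcard) ((norm_nonneg _).trans hδ)

theorem dTV_spec_le_of_le_of_le {M : Matrix (Fin d) (Fin d) ℂ} (hA : A.IsHermitian)
    (hA' : A'.IsHermitian) (h : A ≤ M) (h' : A' ≤ M) :
    dTV (spec hA) (spec hA') ≤ 1 / 2 * ((M - A).trace.re + (M - A').trace.re) := by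
  have hM : M.IsHermitian := by
    simpa using (Matrix.le_iff.1 h).isHermitian.add hA
  rw [dTV]
  gcongr
  calc
    _ ≤ ∑ i, ((spec hM i - spec hA i) + (spec hM i - spec hA' i)) := by
      refine Finset.sum_le_sum fun i _ => abs_sub_le_iff.2 ⟨?_, ?_⟩ <;>
        linarith [spec_mono hA hM h i, spec_mono hA' hM h' i]
    _ = (M - A).trace.re + (M - A').trace.re := by
      simp only [Finset.sum_add_distrib, Finset.sum_sub_distrib, sum_spec, Matrix.trace_sub,
        Complex.sub_re]

end Spectrum

section OffDiagonal

variable {𝒜 : Type*} [CStarAlgebra 𝒜] [PartialOrder 𝒜] [StarOrderedRing 𝒜] {p q D : 𝒜} {δ : ℝ}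

theorem neg_offDiag_le (hp : IsStarProjection p) (hq : IsSelfAdjoint q) (hD : IsSelfAdjoint D)
    (hδ : 0 < δ) :
    -(p * D * q + q * D * p) ≤ δ • p + δ⁻¹ • (q * D * p * (p * D * q)) := by
  -- Expand `0 ≤ δ⁻¹ (δ p + q D p) (δ p + q D p)⋆`.
  have hstar : star (δ • p + q * D * p) = δ • p + p * D * q := by
    simp only [star_add, star_smul, star_trivial, star_mul, hp.isSelfAdjoint.star_eq, hq.star_eq,
      hD.star_eq, mul_assoc]
  have hsquare := smul_nonneg (inv_pos.2 hδ).le (mul_star_self_nonneg (δ • p + q * D * p))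
  rw [hstar] at hsquare
  have hpp (x : 𝒜) : p * (p * x) = p * x := by rw [← mul_assoc, hp.isIdempotentElem.eq]
  rw [neg_le_iff_add_nonneg]
  convert hsquare using 1
  simp only [add_mul, mul_add, smul_mul_assoc, mul_smul_comm, smul_add, smul_smul, mul_assoc, hpp,
    hp.isIdempotentElem.eq, inv_mul_cancel₀ hδ.ne', inv_mul_cancel_left₀ hδ.ne', one_smul]
  abel

theorem offDiag_mul_offDiag_le (hp : IsStarProjection p) (hq : IsStarProjection q)
    (hD : IsSelfAdjoint D) :
    p * D * q * (q * D * p) ≤ ‖D‖ ^ 2 • p := by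
  have hnorm : ‖q * D‖ ≤ ‖D‖ :=
    (norm_mul_le q D).trans (mul_le_of_le_one_left (norm_nonneg D) hq.norm_le)
  calc
    p * D * q * (q * D * p) = p * (star (q * D) * (q * D)) * p := by
      simp only [star_mul, hq.isSelfAdjoint.star_eq, hD.star_eq, mul_assoc]
    _ ≤ p * algebraMap ℝ 𝒜 (‖q * D‖ ^ 2) * p :=
      hp.isSelfAdjoint.conjugate_le_conjugate CStarAlgebra.star_mul_le_algebraMap_norm_sq
    _ = ‖q * D‖ ^ 2 • p := by
      rw [Algebra.algebraMap_eq_smul_one, mul_smul_comm, mul_one, smul_mul_assoc,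
        hp.isIdempotentElem.eq]
    _ ≤ ‖D‖ ^ 2 • p := by
      have := hp.nonneg
      gcongr

end OffDiagonal

section Pinching

variable {d : ℕ} {P ρ σ : Matrix (Fin d) (Fin d) ℂ}

theorem trace_pinch (hP : IsIdempotentElem P) (ρ : Matrix (Fin d) (Fin d) ℂ) :
    (pinch P ρ).trace = ρ.trace := by
  rw [pinch, Matrix.trace_add, Matrix.trace_mul_cycle, hP.eq, Matrix.trace_mul_cycle,
    hP.one_sub.eq, ← Matrix.trace_add, ← add_mul, add_sub_cancel, one_mul]

theorem pinch_sub_self (hP : IsIdempotentElem P) (hPσ : Commute P σ)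
    (ρ : Matrix (Fin d) (Fin d) ℂ) :
    pinch P ρ - ρ = -(P * (ρ - σ) * (1 - P) + (1 - P) * (ρ - σ) * P) := by
  have hσ : P * σ * (1 - P) + (1 - P) * σ * P = 0 := by
    rw [hPσ.eq, mul_assoc, hP.mul_one_sub_self, mul_zero, mul_assoc, ← hPσ.eq, ← mul_assoc,
      hP.one_sub_mul_self, zero_mul, add_zero]
  calc
    pinch P ρ - ρ = -(P * ρ * (1 - P) + (1 - P) * ρ * P) := by rw [pinch]; noncomm_ring
    _ = -(P * ρ * (1 - P) + (1 - P) * ρ * P) + (P * σ * (1 - P) + (1 - P) * σ * P) := by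
      rw [hσ, add_zero]
    _ = _ := by noncomm_ring

theorem dTV_spec_pinch_le (hP : IsStarProjection P) (hPσ : Commute P σ) (hρ : ρ.IsHermitian)
    (hσ : σ.IsHermitian) {δ : ℝ} (hδ : 0 < δ) (hρσ : opNorm (ρ - σ) ≤ δ) :
    dTV (spec (isHermitian_pinch hP.isSelfAdjoint hρ)) (spec hρ) ≤ 2 * P.trace.re * δ := by
  have hD : IsSelfAdjoint (ρ - σ) := (hρ.sub hσ).isSelfAdjoint
  set Y := (1 - P) * (ρ - σ) * P * (P * (ρ - σ) * (1 - P)) with hY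
  set N := δ • P + δ⁻¹ • Y with hN
  have hpinch : pinch P ρ ≤ ρ + N := by
    rw [← sub_le_iff_le_add', pinch_sub_self hP.isIdempotentElem hPσ]
    exact neg_offDiag_le hP hP.one_sub.isSelfAdjoint hD hδ
  have hYnonneg : 0 ≤ Y := by
    convert star_mul_self_nonneg (P * (ρ - σ) * (1 - P)) using 1
    simp only [hY, star_mul, hP.isSelfAdjoint.star_eq, hP.one_sub.isSelfAdjoint.star_eq,
      hD.star_eq, mul_assoc]
  have hself : ρ ≤ ρ + N := le_add_of_nonneg_right
    (add_nonneg (smul_nonneg hδ.le hP.nonneg) (smul_nonneg (inv_nonneg.2 hδ.le) hYnonneg))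
  have htraceY : Y.trace.re ≤ δ ^ 2 * P.trace.re := by
    have h := trace_re_mono (offDiag_mul_offDiag_le hP hP.one_sub hD)
    rw [Matrix.trace_mul_comm, Matrix.trace_smul, Complex.smul_re, smul_eq_mul] at h
    have hPtrace : 0 ≤ P.trace.re := by simpa using trace_re_mono hP.nonneg
    have hnorm : ‖ρ - σ‖ ≤ δ := hρσ
    exact h.trans (by gcongr)
  have htraceN : N.trace.re ≤ 2 * δ * P.trace.re := by
    simp only [hN, Matrix.trace_add, Matrix.trace_smul, Complex.add_re, Complex.smul_re,
      smul_eq_mul]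
    calc
      _ ≤ δ * P.trace.re + δ⁻¹ * (δ ^ 2 * P.trace.re) := by gcongr
      _ = 2 * δ * P.trace.re := by field_simp; ring
  have h := dTV_spec_le_of_le_of_le (isHermitian_pinch hP.isSelfAdjoint hρ) hρ hpinch hself
  rw [add_sub_cancel_left, add_sub_right_comm, Matrix.trace_add, Matrix.trace_sub,
    trace_pinch hP.isIdempotentElem, sub_self, zero_add] at h
  linarith

end Pinching

section Threshold

variable {d : ℕ} {A ρ : Matrix (Fin d) (Fin d) ℂ}

theorem trace_eq_rank {P : Matrix (Fin d) (Fin d) ℂ} (hP : IsIdempotentElem P) :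
    P.trace = P.rank := by
  have h : IsIdempotentElem (Matrix.toLin' P) := by
    rw [IsIdempotentElem, Module.End.mul_eq_comp, ← Matrix.toLin'_mul, hP.eq]
  rw [← Matrix.trace_toLin'_eq, (LinearMap.IsIdempotentElem.isProj_range _ h).trace, Matrix.rank,
    Matrix.toLin'_apply']

theorem thresholdProj_eq_cfc (hA : A.IsHermitian) (B : ℝ) :
    thresholdProj hA B = cfc (fun x => if B ≤ x then (1 : ℝ) else 0) A := by
  rw [hA.cfc_eq, Matrix.IsHermitian.cfc, Unitary.conjStarAlgAut_apply]
  ext i k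
  rw [thresholdProj, Matrix.sum_apply, Matrix.mul_apply]
  refine Finset.sum_congr rfl fun j _ => ?_
  rw [Matrix.mul_diagonal]
  split_ifs with h <;> simp [Matrix.vecMulVec_apply, h]

theorem one_sub_thresholdProj_eq_cfc (hA : A.IsHermitian) (B : ℝ) :
    1 - thresholdProj hA B = cfc (fun x => if B ≤ x then (0 : ℝ) else 1) A := by
  have hfin := A.finite_real_spectrum
  rw [thresholdProj_eq_cfc, ← cfc_one ℝ A hA.isSelfAdjoint,
    ← cfc_sub _ _ A (hfin.continuousOn _) (hfin.continuousOn _)]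
  congr 1
  ext x
  simp only [Pi.one_apply]
  split_ifs <;> norm_num

theorem isStarProjection_thresholdProj (hA : A.IsHermitian) (B : ℝ) :
    IsStarProjection (thresholdProj hA B) := by
  have hfin := A.finite_real_spectrum
  refine ⟨?_, (isHermitian_thresholdProj hA B).isSelfAdjoint⟩
  rw [IsIdempotentElem, thresholdProj_eq_cfc,
    ← cfc_mul _ _ A (hfin.continuousOn _) (hfin.continuousOn _)]
  congr 1
  ext x
  split_ifs <;> norm_num

theorem commute_thresholdProj (hA : A.IsHermitian) (B : ℝ) : Commute (thresholdProj hA B) A := by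
  rw [thresholdProj_eq_cfc]
  exact (Commute.refl A).cfc_real _

theorem cfc_mul_mul_cfc (hA : A.IsHermitian) (f : ℝ → ℝ) :
    cfc f A * A * cfc f A = cfc (fun x => f x * x * f x) A := by
  have hcont (g : ℝ → ℝ) : ContinuousOn g (spectrum ℝ A) := A.finite_real_spectrum.continuousOn g
  rw [cfc_mul _ _ A (hcont _) (hcont _), cfc_mul _ _ A (hcont _) (hcont _),
    cfc_id' ℝ A hA.isSelfAdjoint]

theorem smul_thresholdProj_le (hA : A.IsHermitian) (B : ℝ) :
    B • thresholdProj hA B ≤ thresholdProj hA B * A * thresholdProj hA B := by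
  have hfin := A.finite_real_spectrum
  rw [thresholdProj_eq_cfc, cfc_mul_mul_cfc hA, ← cfc_smul _ _ A (hfin.continuousOn _)]
  refine cfc_mono (fun x _ => ?_) (hfin.continuousOn _) (hfin.continuousOn _)
  split_ifs with h <;> simp [h]

theorem one_sub_thresholdProj_conj_le (hA : A.IsHermitian) (B : ℝ) :
    (1 - thresholdProj hA B) * A * (1 - thresholdProj hA B) ≤ B • (1 - thresholdProj hA B) := by
  have hfin := A.finite_real_spectrum
  rw [one_sub_thresholdProj_eq_cfc, cfc_mul_mul_cfc hA, ← cfc_smul _ _ A (hfin.continuousOn _)]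
  refine cfc_mono (fun x _ => ?_) (hfin.continuousOn _) (hfin.continuousOn _)
  split_ifs with h
  · simp
  · simpa using (not_le.1 h).le

theorem conj_le_conj_add_smul {P : Matrix (Fin d) (Fin d) ℂ} (hP : IsStarProjection P)
    (hA : A.IsHermitian) (hρ : ρ.IsHermitian) :
    P * A * P ≤ P * ρ * P + opNorm (A - ρ) • P := by
  have h := hP.isSelfAdjoint.conjugate_le_conjugate (le_add_algebraMap_opNorm_sub hA hρ)
  rwa [mul_add, add_mul, Algebra.algebraMap_eq_smul_one, mul_smul_comm, mul_one, smul_mul_assoc,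
    hP.isIdempotentElem.eq] at h

theorem opNorm_one_sub_thresholdProj_conj_le (hA : A.IsHermitian) {B : ℝ} (hB : 0 ≤ B)
    (hρ : ρ.PosSemidef) :
    opNorm ((1 - thresholdProj hA B) * ρ * (1 - thresholdProj hA B)) ≤ B + opNorm (A - ρ) := by
  have hQ := (isStarProjection_thresholdProj hA B).one_sub
  have hbound : 0 ≤ B + opNorm (A - ρ) := add_nonneg hB (norm_nonneg _)
  have hconj := conj_le_conj_add_smul hQ hρ.isHermitian hA
  rw [opNorm_sub_comm] at hconj
  refine (CStarAlgebra.norm_le_iff_le_algebraMap _ hbound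
    (hQ.isSelfAdjoint.conjugate_nonneg hρ.nonneg)).2 ?_
  calc
    _ ≤ B • (1 - thresholdProj hA B) + opNorm (A - ρ) • (1 - thresholdProj hA B) :=
      hconj.trans (by gcongr; exact one_sub_thresholdProj_conj_le hA B)
    _ = (B + opNorm (A - ρ)) • (1 - thresholdProj hA B) := (add_smul _ _ _).symm
    _ ≤ (B + opNorm (A - ρ)) • 1 := smul_le_smul_of_nonneg_left hQ.le_one hbound
    _ = _ := (Algebra.algebraMap_eq_smul_one _).symm

theorem rank_thresholdProj_mul_le (hA : A.IsHermitian) (B : ℝ) (hρ : ρ.PosSemidef) :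
    (thresholdProj hA B).rank * (B - opNorm (A - ρ)) ≤ ρ.trace.re := by
  have hP := isStarProjection_thresholdProj hA B
  have hQρQ := trace_re_mono (hP.one_sub.isSelfAdjoint.conjugate_nonneg hρ.nonneg)
  have hpinch := congrArg Complex.re (trace_pinch hP.isIdempotentElem ρ)
  have h := trace_re_mono
    ((smul_thresholdProj_le hA B).trans (conj_le_conj_add_smul hP hA hρ.isHermitian))
  simp only [pinch, Matrix.trace_add, Matrix.trace_smul, Matrix.trace_zero, Complex.add_re,
    Complex.smul_re, Complex.zero_re, smul_eq_mul, trace_eq_rank hP.isIdempotentElem,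
    Complex.natCast_re] at h hpinch hQρQ
  linarith

theorem rank_thresholdProj_le (hA : A.IsHermitian) {B : ℝ} (hB : 0 < B) (hρ : IsDensityMatrix ρ)
    (hAρ : opNorm (A - ρ) ≤ B / 3) : (thresholdProj hA B).rank ≤ 3 / (2 * B) := by
  have hmul := rank_thresholdProj_mul_le hA B hρ.posSemidef
  rw [hρ.trace_eq_one, Complex.one_re] at hmul
  rw [le_div_iff₀ (by positivity)]
  nlinarith [mul_le_mul_of_nonneg_left hAρ (Nat.cast_nonneg (α := ℝ) (thresholdProj hA B).rank)]

theorem dTV_spec_pinch_thresholdProj_le (hA : A.IsHermitian) (B : ℝ) (hρ : ρ.IsHermitian) {δ : ℝ}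
    (hδ : 0 < δ) (hAρ : opNorm (A - ρ) ≤ δ) :
    dTV (spec (isHermitian_pinch (isHermitian_thresholdProj hA B) hρ)) (spec hρ) ≤
      2 * (thresholdProj hA B).rank * δ := by
  have hP := isStarProjection_thresholdProj hA B
  rw [opNorm_sub_comm] at hAρ
  have h := dTV_spec_pinch_le hP (commute_thresholdProj hA B) hρ hA hδ hAρ
  rwa [trace_eq_rank hP.isIdempotentElem, Complex.natCast_re] at h

end Threshold

end UniformPOVM

theorem theorem6p1 :
    ∃ C : ℝ, 0 < C ∧
      ∀ (d : ℕ) (ρ : Matrix (Fin d) (Fin d) ℂ) (hρ : UniformPOVM.IsDensityMatrix ρ)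
        (B ε : ℝ), 0 < B → B ≤ 1 → 0 < ε → ε ≤ 1 →
      ∀ n : ℕ, C * d * B⁻¹ ^ 2 * ε⁻¹ ^ 2 ≤ n →
      ∃ E : Set (Fin n → UniformPOVM.PureState d), MeasurableSet E ∧
        (99 / 100 : ℝ≥0∞) ≤ UniformPOVM.uniformPOVMCopies ρ n E ∧
        ∀ u ∈ E,
          UniformPOVM.dTV
              (UniformPOVM.firstEntries (UniformPOVM.bucket B u).rank
                (UniformPOVM.spec (UniformPOVM.isHermitian_estimate u)))
              (UniformPOVM.firstEntries (UniformPOVM.bucket B u).rank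
                (UniformPOVM.spec hρ.posSemidef.isHermitian)) ≤ ε ∧
          ((UniformPOVM.bucket B u).rank : ℝ) ≤ 3 / (2 * B) ∧
          UniformPOVM.opNorm
              ((1 - UniformPOVM.bucket B u) * ρ * (1 - UniformPOVM.bucket B u)) ≤ (1 + ε) * B ∧
          UniformPOVM.dTV
              (UniformPOVM.spec (UniformPOVM.isHermitian_pinch
                (UniformPOVM.isHermitian_bucket B u) hρ.posSemidef.isHermitian))
              (UniformPOVM.spec hρ.posSemidef.isHermitian) ≤ ε := by
  refine ⟨16896, by norm_num, fun d ρ hρ B ε hB hB1 hε hε1 n hn => ?_⟩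
  have hBε : B * ε ≤ B := mul_le_of_le_one_right hB.le hε1
  have hδ : 0 < B * ε / 4 := by positivity
  have hsamples : 1056 * d ≤ n * (B * ε / 4) ^ 2 :=
    calc
      1056 * (d : ℝ) = 16896 * d * B⁻¹ ^ 2 * ε⁻¹ ^ 2 * (B * ε / 4) ^ 2 := by field_simp; ring
      _ ≤ n * (B * ε / 4) ^ 2 := by gcongr
  refine ⟨_, UniformPOVM.measurableSet_opNorm_estimate_sub_le ρ n (B * ε / 4),
    UniformPOVM.le_uniformPOVMCopies_opNorm_estimate_sub_le hρ hδ.le (by linarith) hsamples,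
    fun u (hu : UniformPOVM.opNorm (UniformPOVM.estimate u - ρ) ≤ B * ε / 4) => ?_⟩
  have hσ := UniformPOVM.isHermitian_estimate u
  have hrank : ((UniformPOVM.bucket B u).rank : ℝ) ≤ 3 / (2 * B) :=
    UniformPOVM.rank_thresholdProj_le hσ hB hρ (by linarith)
  have hrankδ : ((UniformPOVM.bucket B u).rank : ℝ) * (B * ε / 4) ≤ 3 / 8 * ε :=
    (mul_le_mul_of_nonneg_right hrank hδ.le).trans_eq (by field_simp; norm_num)
  refine ⟨?_, hrank, ?_, ?_⟩
  · exact (UniformPOVM.dTV_firstEntries_spec_le hσ hρ.isHermitian _ hu).trans (by linarith)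
  · exact (UniformPOVM.opNorm_one_sub_thresholdProj_conj_le hσ hB.le hρ.posSemidef).trans
      (by linarith [mul_pos hB hε])
  · refine (UniformPOVM.dTV_spec_pinch_thresholdProj_le hσ B hρ.isHermitian hδ hu).trans ?_
    rw [← UniformPOVM.bucket]
    linarith
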